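/- **Setting.** All nets are indexed by $\varepsilon\in(0,1]$ and all $O$-estimates are for $\varepsilon\to0$. For $\mathbb K=\mathbb R$ or $\mathbb C$, let $\widetilde{\mathbb K}$ be the ring of generalized numbers, i.e. moderate nets $(a_\varepsilon)_\varepsilon$ in $\mathbb K$ ($|a_\varepsilon|=O(\varepsilon^{b})$ for some $b\in\mathbb R$) modulo negligible nets ($|a_\varepsilon|=O(\varepsilon^{b})$ for all $b\in\mathbb R$). The valuation of $a=[(a_\varepsilon)_\varepsilon]$ is $\mathrm{val}(a)=\sup\{b\in\mathbb R: |a_\varepsilon|=O(\varepsilon^b)\}\in(-\infty,+\infty]$. For $\xi=[(\xi_\varepsilon)_\varepsilon]\in\widetilde{\mathbb R}^n$ put $|\xi|=[(|\xi_\varepsilon|)_\varepsilon]\in\widetilde{\mathbb R}$ (Euclidean norm); $\xi$ is of *log-type* if it has a representative with $|\xi_\varepsilon|=O(\log(1/\varepsilon))$. For $\zeta\in\widetilde{\mathbb C}^n$, $\mathrm{Re}\,\zeta,\mathrm{Im}\,\zeta\in\widetilde{\mathbb R}^n$ are defined componentwise. For $\Omega\subseteq\mathbb R^n$ open, let $\mathcal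 G(\Omega)$ be the Colombeau algebra: nets $(u_\varepsilon)_\varepsilon$ in $C^\infty(\Omega)$ such that for all compact $K\subset\Omega$ and all $\alpha\in\mathbb N^n$ there is $b\in\mathbb R$ with $\sup_{K}|\partial^\alpha u_\varepsilon|=O(\varepsilon^{b})$, modulo those nets for which this holds for all $K$, $\alpha$ and all $b\in\mathbb R$. Let $\mathcal G^\infty(\Omega)\subseteq\mathcal G(\Omega)$ consist of the elements having a representative such that for all compact $K\subset\Omega$ there is a single $b\in\mathbb R$ with $\sup_K|\partial^\alpha u_\varepsilon|=O(\varepsilon^b)$ for all $\alpha\in\mathbb N^n$. The $\mathcal G^\infty$-singular support of $u\in\mathcal G(\Omega)$ is the complement in $\Omega$ of the set of points $x\in\Omega$ having an open neighbourhood $V\subseteq\Omega$ with $u|_V\in\mathcal G^\infty(V)$. For a polynomial $P(\xi)=\sum_{|\alpha|\le m}c_\alpha\xi^\alpha$ in $n$ variables with coefficients $c_\alpha\in\widetilde{\mathbb C}$, put $P(D)=\sum_{|\alpha|\le m}c_\alpha D^\alpha$, $D_j=-i\partial_j$, acting on each $\mathcal G(\Omega)$. The operator $P(D)$ is $\mathcal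 G^\infty$-*hypoelliptic* if for every open $\Omega\subseteq\mathbb R^n$ and every $u\in\mathcal G(\Omega)$ the $\mathcal G^\infty$-singular supports of $P(D)u$ and $u$ coincide. **Theorem.** Let $P(D)$ be a partial differential operator with (constant) coefficients in $\widetilde{\mathbb C}$ and let $N(P)$ be the set of all zeros $\zeta\in\widetilde{\mathbb C}^n$ of $P$ (i.e. $P(\zeta)=0$ in $\widetilde{\mathbb C}$) such that $\mathrm{Im}\,\zeta$ is of log-type. If $P(D)$ is $\mathcal G^\infty$-hypoelliptic, then $$\mathrm{val}(|\mathrm{Re}\,\zeta|)\ge 0\qquad\text{for all }\zeta\in N(P).$$ -/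

import Mathlib

open Filter Topology Asymptotics
open scoped ContDiff

noncomputable section

namespace Colombeau

/-- The index set `(0,1]` of the regularization parameter `ε`. -/
abbrev Eps : Type := Set.Ioc (0 : ℝ) 1

/-- The filter `ε → 0` on `(0,1]`. -/
def toZero : Filter Eps := comap (fun ε : Eps => (ε : ℝ)) (𝓝 0)

/-- The net `ε ↦ ε ^ b` for a real exponent `b`. -/
def epsPow (b : ℝ) : Eps → ℝ := fun ε => (ε : ℝ) ^ b

theorem epsPow_pos (b : ℝ) (ε : Eps) : 0 < epsPow b ε := Real.rpow_pos_of_pos ε.2.1 b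

theorem epsPow_add (b c : ℝ) (ε : Eps) : epsPow (b + c) ε = epsPow b ε * epsPow c ε :=
  Real.rpow_add ε.2.1 b c

theorem epsPow_anti {b c : ℝ} (h : b ≤ c) (ε : Eps) : epsPow c ε ≤ epsPow b ε :=
  Real.rpow_le_rpow_of_exponent_ge ε.2.1 ε.2.2 h

theorem epsPow_isBigO {b c : ℝ} (h : b ≤ c) : epsPow c =O[toZero] epsPow b :=
  IsBigO.of_bound 1 (Eventually.of_forall fun ε => by
    rw [Real.norm_of_nonneg (epsPow_pos c ε).le, Real.norm_of_nonneg (epsPow_pos b ε).le, one_mul]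
    exact epsPow_anti h ε)

/-! ### Generalized numbers -/

section Numbers

variable (𝕜 : Type) [RCLike 𝕜]

/-- The ring of moderate nets of scalars: `|a_ε| = O(ε^b)` as `ε → 0` for some real `b`. -/
def moderateNet : Subring (Eps → 𝕜) where
  carrier := {a | ∃ b : ℝ, a =O[toZero] epsPow b}
  mul_mem' := by
    rintro a a' ⟨b, hb⟩ ⟨b', hb'⟩
    refine ⟨b + b', ?_⟩
    have : epsPow (b + b') = fun ε => epsPow b ε * epsPow b' ε := funext (epsPow_add b b')
    rw [this]
    exact hb.mul hb'
  one_mem' := ⟨0, IsBigO.of_bound 1 (Eventually.of_forall fun ε => by simp [epsPow])⟩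
  add_mem' := by
    rintro a a' ⟨b, hb⟩ ⟨b', hb'⟩
    exact ⟨min b b', (hb.trans (epsPow_isBigO (min_le_left _ _))).add
      (hb'.trans (epsPow_isBigO (min_le_right _ _)))⟩
  zero_mem' := ⟨0, isBigO_zero _ _⟩
  neg_mem' := by
    rintro a ⟨b, hb⟩
    exact ⟨b, hb.neg_left⟩

/-- The ideal of negligible nets of scalars: `|a_ε| = O(ε^b)` as `ε → 0` for all real `b`. -/
def negligibleNet : Ideal (moderateNet 𝕜) where
  carrier := {a | ∀ b : ℝ, (a : Eps → 𝕜) =O[toZero] epsPow b}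
  add_mem' := by
    intro a a' h h' b
    exact (h b).add (h' b)
  zero_mem' := fun b => isBigO_zero _ _
  smul_mem' := by
    rintro ⟨c, d, hd⟩ a h b
    have : epsPow b = fun ε => epsPow d ε * epsPow (b - d) ε := by
      funext ε
      rw [← epsPow_add]
      congr 1
      ring
    rw [this]
    exact hd.mul (h (b - d))

/-- The ring of generalized numbers over `𝕜`, moderate nets modulo negligible nets. -/
def GenNum : Type := moderateNet 𝕜 ⧸ negligibleNet 𝕜

instance genNumCommRing : CommRing (GenNum 𝕜) :=
  inferInstanceAs (CommRing (moderateNet 𝕜 ⧸ negligibleNet 𝕜))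

end Numbers

/-- The ring of generalized real numbers. -/
abbrev GenReal : Type := GenNum ℝ

/-- The ring of generalized complex numbers. -/
abbrev GenComplex : Type := GenNum ℂ

section NumberMaps

variable {𝕜 : Type} [RCLike 𝕜]

/-- The class `[(a_ε)_ε]` of a moderate net. -/
def numClass (a : moderateNet 𝕜) : GenNum 𝕜 := Ideal.Quotient.mk (negligibleNet 𝕜) a

theorem numClass_eq_iff {a a' : moderateNet 𝕜} :
    numClass a = numClass a' ↔
      ∀ b : ℝ, (fun ε => (a : Eps → 𝕜) ε - (a' : Eps → 𝕜) ε) =O[toZero] epsPow b :=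
  Ideal.Quotient.eq

theorem numClass_surjective : Function.Surjective (numClass (𝕜 := 𝕜)) :=
  Ideal.Quotient.mk_surjective

/-- A real-linear map `f : ℂ → ℝ` applied to a moderate net. -/
def mapNet (f : ℂ →L[ℝ] ℝ) (a : moderateNet ℂ) : moderateNet ℝ :=
  ⟨fun ε => f ((a : Eps → ℂ) ε), by
    obtain ⟨a, b, hb⟩ := a
    exact ⟨b, (f.isBigO_comp a toZero).trans hb⟩⟩

/-- The map `[(a_ε)_ε] ↦ [(f(a_ε))_ε]` induced by a real-linear map `f : ℂ → ℝ`. -/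
def mapNum (f : ℂ →L[ℝ] ℝ) : GenComplex → GenReal :=
  Quotient.lift (fun a => numClass (mapNet f a)) (by
    intro a a' h
    have h' : numClass a = numClass a' := Quotient.sound h
    rw [numClass_eq_iff] at h' ⊢
    intro b
    have e : (fun ε => (mapNet f a : Eps → ℝ) ε - (mapNet f a' : Eps → ℝ) ε) =
        fun ε => f ((a : Eps → ℂ) ε - (a' : Eps → ℂ) ε) := by
      funext ε
      exact (map_sub f _ _).symm
    rw [e]
    exact (f.isBigO_comp _ toZero).trans (h' b))

theorem mapNum_numClass (f : ℂ →L[ℝ] ℝ) (a : moderateNet ℂ) :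
    mapNum f (numClass a) = numClass (mapNet f a) := rfl

/-- The componentwise real part `ζ ↦ Re ζ` of a generalized point. -/
def rePart {n : ℕ} (ζ : Fin n → GenComplex) : Fin n → GenReal :=
  fun j => mapNum Complex.reCLM (ζ j)

/-- The componentwise imaginary part `ζ ↦ Im ζ` of a generalized point. -/
def imPart {n : ℕ} (ζ : Fin n → GenComplex) : Fin n → GenReal :=
  fun j => mapNum Complex.imCLM (ζ j)

/-- The net of Euclidean norms `|ξ_ε|` of a net of points `ξ_ε ∈ ℝⁿ`, given by its components. -/
def normNet {n : ℕ} (r : Fin n → moderateNet ℝ) : Eps → ℝ :=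
  fun ε => ‖(WithLp.toLp 2 fun j => (r j : Eps → ℝ) ε : EuclideanSpace ℝ (Fin n))‖

theorem norm_toLp_le_sum {n : ℕ} (v : Fin n → ℝ) :
    ‖(WithLp.toLp 2 v : EuclideanSpace ℝ (Fin n))‖ ≤ ∑ j, ‖v j‖ := by
  have h : (WithLp.toLp 2 v : EuclideanSpace ℝ (Fin n)) =
      ∑ j, EuclideanSpace.single j (v j) := by
    ext i
    simp [Finset.sum_apply, Pi.single_apply]
  rw [h]
  refine (norm_sum_le _ _).trans (le_of_eq ?_)
  simp

theorem normNet_isBigO {n : ℕ} (r : Fin n → Eps → ℝ) {g : Eps → ℝ}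
    (h : ∀ j, r j =O[toZero] g) :
    (fun ε => ‖(WithLp.toLp 2 fun j => r j ε : EuclideanSpace ℝ (Fin n))‖) =O[toZero] g := by
  have h1 : (fun ε => ∑ j, ‖r j ε‖) =O[toZero] g :=
    IsBigO.fun_sum fun j _ => (h j).norm_left
  refine IsBigO.trans (IsBigO.of_bound 1 (Eventually.of_forall fun ε => ?_)) h1
  rw [norm_norm, one_mul]
  exact (norm_toLp_le_sum _).trans (le_abs_self _)

theorem normNet_mem {n : ℕ} (r : Fin n → moderateNet ℝ) : normNet r ∈ moderateNet ℝ := by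
  choose b hb using fun j => (r j).2
  refine ⟨-∑ i, |b i|, normNet_isBigO _ fun j => (hb j).trans (epsPow_isBigO ?_)⟩
  have : |b j| ≤ ∑ i, |b i| :=
    Finset.single_le_sum (f := fun i => |b i|) (fun i _ => abs_nonneg _) (Finset.mem_univ j)
  linarith [neg_abs_le (b j)]

/-- The generalized Euclidean norm `|ξ| = [(|ξ_ε|)_ε]` of `ξ = [(ξ_ε)_ε]`. The choice of the
representative is immaterial by `genNorm_numClass`. -/
def genNorm {n : ℕ} (ξ : Fin n → GenReal) : GenReal :=
  numClass ⟨normNet fun j => (numClass_surjective (ξ j)).choose, normNet_mem _⟩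

theorem genNorm_numClass {n : ℕ} (r : Fin n → moderateNet ℝ) :
    genNorm (fun j => numClass (r j)) = numClass ⟨normNet r, normNet_mem r⟩ := by
  unfold genNorm
  rw [numClass_eq_iff]
  intro b
  have key : ∀ j, (fun ε => ((numClass_surjective (numClass (r j))).choose : Eps → ℝ) ε
      - (r j : Eps → ℝ) ε) =O[toZero] epsPow b := fun j =>
    numClass_eq_iff.1 (numClass_surjective (numClass (r j))).choose_spec b
  refine IsBigO.trans (IsBigO.of_bound 1 (Eventually.of_forall fun ε => ?_))
    (normNet_isBigO _ key)
  rw [norm_norm, one_mul, Real.norm_eq_abs]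
  refine (abs_norm_sub_norm_le _ _).trans (le_of_eq ?_)
  rw [← WithLp.toLp_sub]
  rfl

/-- The valuation `val(x) = sup {b ∈ ℝ : |x_ε| = O(ε^b) as ε → 0} ∈ [-∞, +∞]`, where `(x_ε)_ε` is
a representative of `x`; two representatives differ by a negligible net, so that the condition does
not depend on which one is used. -/
def val (x : GenNum 𝕜) : EReal :=
  sSup {s : EReal | ∃ b : ℝ, s = (b : EReal) ∧
    ∃ a : moderateNet 𝕜, numClass a = x ∧ (a : Eps → 𝕜) =O[toZero] epsPow b}

/-- `ξ ∈ ℝ̃ⁿ` is of log-type: some representative satisfies `|ξ_ε| = O(log(1/ε))`. -/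
def IsLogType {n : ℕ} (ξ : Fin n → GenReal) : Prop :=
  ∃ r : Fin n → moderateNet ℝ, (∀ j, numClass (r j) = ξ j) ∧
    normNet r =O[toZero] fun ε : Eps => Real.log (1 / (ε : ℝ))

end NumberMaps

/-! ### Generalized functions -/

section Functions

variable {n : ℕ}

/-- The partial derivative `∂_j f`. -/
def partialD (j : Fin n) (f : EuclideanSpace ℝ (Fin n) → ℂ) : EuclideanSpace ℝ (Fin n) → ℂ :=
  fun x => fderiv ℝ f x (EuclideanSpace.single j 1)

/-- The iterated partial derivative `∂_{j₁} ⋯ ∂_{j_k} f` for `w = [j₁, …, j_k]`. For smooth `f` these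
are exactly the derivatives `∂^α f`, `α ∈ ℕⁿ`. -/
def iterD (w : List (Fin n)) (f : EuclideanSpace ℝ (Fin n) → ℂ) : EuclideanSpace ℝ (Fin n) → ℂ :=
  w.foldr partialD f

theorem iterD_cons (j : Fin n) (w : List (Fin n)) (f : EuclideanSpace ℝ (Fin n) → ℂ) :
    iterD (j :: w) f = partialD j (iterD w f) := rfl

theorem iterD_partialD (j : Fin n) (w : List (Fin n)) (f : EuclideanSpace ℝ (Fin n) → ℂ) :
    iterD w (partialD j f) = iterD (w ++ [j]) f := by
  simp [iterD]

variable {Ω : TopologicalSpace.Opens (EuclideanSpace ℝ (Fin n))}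

theorem contDiffOn_partialD (j : Fin n) {f : EuclideanSpace ℝ (Fin n) → ℂ}
    (hf : ContDiffOn ℝ ∞ f Ω) : ContDiffOn ℝ ∞ (partialD j f) Ω :=
  (hf.fderiv_of_isOpen Ω.isOpen (m := ∞) (by simp)).clm_apply contDiffOn_const

theorem contDiffOn_iterD (w : List (Fin n)) {f : EuclideanSpace ℝ (Fin n) → ℂ}
    (hf : ContDiffOn ℝ ∞ f Ω) : ContDiffOn ℝ ∞ (iterD w f) Ω := by
  induction w with
  | nil => exact hf
  | cons j w ih => exact contDiffOn_partialD j ih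

theorem partialD_congr (j : Fin n) {f g : EuclideanSpace ℝ (Fin n) → ℂ}
    (h : Set.EqOn f g Ω) : Set.EqOn (partialD j f) (partialD j g) Ω := by
  intro x hx
  have : f =ᶠ[𝓝 x] g := h.eventuallyEq_of_mem (Ω.isOpen.mem_nhds hx)
  simp only [partialD, this.fderiv_eq]

theorem iterD_congr (w : List (Fin n)) {f g : EuclideanSpace ℝ (Fin n) → ℂ}
    (h : Set.EqOn f g Ω) : Set.EqOn (iterD w f) (iterD w g) Ω := by
  induction w with
  | nil => exact h
  | cons j w ih => exact partialD_congr j ih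

theorem differentiableAt_of_smooth {f : EuclideanSpace ℝ (Fin n) → ℂ}
    (hf : ContDiffOn ℝ ∞ f Ω) {x : EuclideanSpace ℝ (Fin n)} (hx : x ∈ Ω) :
    DifferentiableAt ℝ f x :=
  (hf.contDiffAt (Ω.isOpen.mem_nhds hx)).differentiableAt (by simp)

/-- Iterated derivatives of linear combinations. -/
theorem iterD_lin (w : List (Fin n)) (c d : ℂ) {f g : EuclideanSpace ℝ (Fin n) → ℂ}
    (hf : ContDiffOn ℝ ∞ f Ω) (hg : ContDiffOn ℝ ∞ g Ω) :
    Set.EqOn (iterD w fun x => c * f x + d * g x)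
      (fun x => c * iterD w f x + d * iterD w g x) Ω := by
  induction w with
  | nil => exact fun x _ => rfl
  | cons j w ih =>
    intro x hx
    rw [iterD_cons, partialD_congr j ih hx]
    have h1 := differentiableAt_of_smooth (contDiffOn_iterD w hf) hx
    have h2 := differentiableAt_of_smooth (contDiffOn_iterD w hg) hx
    simp only [partialD, iterD_cons]
    rw [fderiv_fun_add (h1.const_mul c) (h2.const_mul d), fderiv_const_mul h1, fderiv_const_mul h2]
    simp

/-- `sup_{x ∈ K} |u_ε(x)| = O(ε^b)` as `ε → 0`. -/
def UnifBigO (u : Eps → EuclideanSpace ℝ (Fin n) → ℂ) (K : Set (EuclideanSpace ℝ (Fin n)))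
    (b : ℝ) : Prop :=
  ∃ C : ℝ, ∀ᶠ ε in toZero, ∀ x ∈ K, ‖u ε x‖ ≤ C * epsPow b ε

theorem UnifBigO.mono {u : Eps → EuclideanSpace ℝ (Fin n) → ℂ}
    {K : Set (EuclideanSpace ℝ (Fin n))} {b b' : ℝ} (h : UnifBigO u K b) (hb : b' ≤ b) :
    UnifBigO u K b' := by
  obtain ⟨C, hC⟩ := h
  refine ⟨|C|, hC.mono fun ε hε x hx => (hε x hx).trans ?_⟩
  exact mul_le_mul (le_abs_self C) (epsPow_anti hb ε) (epsPow_pos b ε).le (abs_nonneg C)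

/-- Linear combinations `c_ε u_ε + d_ε v_ε` with moderate coefficients. -/
theorem UnifBigO.lin {u v z : Eps → EuclideanSpace ℝ (Fin n) → ℂ} {c d : Eps → ℂ}
    {K : Set (EuclideanSpace ℝ (Fin n))} {a a' b b' s : ℝ}
    (hc : c =O[toZero] epsPow a) (hd : d =O[toZero] epsPow a')
    (hu : UnifBigO u K b) (hv : UnifBigO v K b') (h1 : s ≤ a + b) (h2 : s ≤ a' + b')
    (hz : ∀ ε, ∀ x ∈ K, z ε x = c ε * u ε x + d ε * v ε x) : UnifBigO z K s := by
  obtain ⟨A, hA0, hA⟩ := hc.exists_nonneg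
  obtain ⟨A', hA0', hA'⟩ := hd.exists_nonneg
  obtain ⟨B, hB⟩ := hu
  obtain ⟨B', hB'⟩ := hv
  refine ⟨A * |B| + A' * |B'|, ?_⟩
  filter_upwards [hA.bound, hA'.bound, hB, hB'] with ε e1 e2 e3 e4 x hx
  rw [Real.norm_of_nonneg (epsPow_pos _ ε).le] at e1 e2
  have aux : ∀ {p q : ℂ} {A B a b : ℝ}, 0 ≤ A → s ≤ a + b → ‖p‖ ≤ A * epsPow a ε →
      ‖q‖ ≤ B * epsPow b ε → ‖p * q‖ ≤ A * |B| * epsPow s ε := by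
    intro p q A B a b hA hs hp hq
    have hq' : ‖q‖ ≤ |B| * epsPow b ε :=
      hq.trans (mul_le_mul_of_nonneg_right (le_abs_self B) (epsPow_pos b ε).le)
    calc ‖p * q‖ = ‖p‖ * ‖q‖ := norm_mul p q
      _ ≤ (A * epsPow a ε) * (|B| * epsPow b ε) :=
        mul_le_mul hp hq' (norm_nonneg _) (mul_nonneg hA (epsPow_pos a ε).le)
      _ = A * |B| * epsPow (a + b) ε := by rw [epsPow_add]; ring
      _ ≤ A * |B| * epsPow s ε :=
        mul_le_mul_of_nonneg_left (epsPow_anti hs ε) (mul_nonneg hA (abs_nonneg B))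
  rw [hz ε x hx, add_mul]
  exact (norm_add_le _ _).trans
    (add_le_add (aux hA0 h1 e1 (e3 x hx)) (aux hA0' h2 e2 (e4 x hx)))

theorem one_isBigO_epsPow : (fun _ : Eps => (1 : ℂ)) =O[toZero] epsPow 0 :=
  IsBigO.of_bound 1 (Eventually.of_forall fun ε => by simp [epsPow])

theorem zero_isBigO_epsPow (b : ℝ) : (fun _ : Eps => (0 : ℂ)) =O[toZero] epsPow b :=
  isBigO_zero _ _

variable (Ω)

/-- A net of smooth functions on `Ω`. The values outside the open set `Ω` play no role. -/
def IsSmoothNet (u : Eps → EuclideanSpace ℝ (Fin n) → ℂ) : Prop :=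
  ∀ ε, ContDiffOn ℝ ∞ (u ε) Ω

/-- Moderateness on `Ω`: for every compact `K ⊆ Ω` and every derivative there is a real `b` with
`sup_K |∂^α u_ε| = O(ε^b)`. -/
def IsModerate (u : Eps → EuclideanSpace ℝ (Fin n) → ℂ) : Prop :=
  ∀ K : Set (EuclideanSpace ℝ (Fin n)), IsCompact K → K ⊆ Ω → ∀ w : List (Fin n),
    ∃ b : ℝ, UnifBigO (fun ε => iterD w (u ε)) K b

/-- Negligibility on `Ω`: for every compact `K ⊆ Ω`, every derivative and every real `b`,
`sup_K |∂^α u_ε| = O(ε^b)`. -/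
def IsNegligible (u : Eps → EuclideanSpace ℝ (Fin n) → ℂ) : Prop :=
  ∀ K : Set (EuclideanSpace ℝ (Fin n)), IsCompact K → K ⊆ Ω → ∀ w : List (Fin n),
    ∀ b : ℝ, UnifBigO (fun ε => iterD w (u ε)) K b

/-- Regular moderateness on `Ω`: for every compact `K ⊆ Ω` there is a single real `b` with
`sup_K |∂^α u_ε| = O(ε^b)` for all derivatives. -/
def IsRegular (u : Eps → EuclideanSpace ℝ (Fin n) → ℂ) : Prop :=
  ∀ K : Set (EuclideanSpace ℝ (Fin n)), IsCompact K → K ⊆ Ω →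
    ∃ b : ℝ, ∀ w : List (Fin n), UnifBigO (fun ε => iterD w (u ε)) K b

variable {Ω}

theorem IsSmoothNet.lin {u v : Eps → EuclideanSpace ℝ (Fin n) → ℂ} (hu : IsSmoothNet Ω u)
    (hv : IsSmoothNet Ω v) (c d : Eps → ℂ) :
    IsSmoothNet Ω (fun ε x => c ε * u ε x + d ε * v ε x) := fun ε =>
  (contDiffOn_const.mul (hu ε)).add (contDiffOn_const.mul (hv ε))

theorem IsModerate.lin {u v : Eps → EuclideanSpace ℝ (Fin n) → ℂ} (hu : IsSmoothNet Ω u)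
    (hv : IsSmoothNet Ω v) (mu : IsModerate Ω u) (mv : IsModerate Ω v) {c d : Eps → ℂ}
    {a a' : ℝ} (hc : c =O[toZero] epsPow a) (hd : d =O[toZero] epsPow a') :
    IsModerate Ω (fun ε x => c ε * u ε x + d ε * v ε x) := by
  intro K hK hKΩ w
  obtain ⟨b, hb⟩ := mu K hK hKΩ w
  obtain ⟨b', hb'⟩ := mv K hK hKΩ w
  exact ⟨min (a + b) (a' + b'), UnifBigO.lin hc hd hb hb' (min_le_left _ _) (min_le_right _ _)
    fun ε x hx => iterD_lin w (c ε) (d ε) (hu ε) (hv ε) (hKΩ hx)⟩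

theorem IsNegligible.lin {u v : Eps → EuclideanSpace ℝ (Fin n) → ℂ} (hu : IsSmoothNet Ω u)
    (hv : IsSmoothNet Ω v) (mu : IsNegligible Ω u) (mv : IsNegligible Ω v) {c d : Eps → ℂ}
    {a a' : ℝ} (hc : c =O[toZero] epsPow a) (hd : d =O[toZero] epsPow a') :
    IsNegligible Ω (fun ε x => c ε * u ε x + d ε * v ε x) := by
  intro K hK hKΩ w b
  exact UnifBigO.lin hc hd (mu K hK hKΩ w (b - a)) (mv K hK hKΩ w (b - a')) (by linarith)
    (by linarith) fun ε x hx => iterD_lin w (c ε) (d ε) (hu ε) (hv ε) (hKΩ hx)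

theorem IsNegligible.congr {u v : Eps → EuclideanSpace ℝ (Fin n) → ℂ} (h : IsNegligible Ω u)
    (huv : ∀ ε, Set.EqOn (u ε) (v ε) Ω) : IsNegligible Ω v := by
  intro K hK hKΩ w b
  obtain ⟨C, hC⟩ := h K hK hKΩ w b
  refine ⟨C, hC.mono fun ε hε x hx => ?_⟩
  show ‖iterD w (v ε) x‖ ≤ _
  rw [← iterD_congr w (huv ε) (hKΩ hx)]
  exact hε x hx

theorem iterD_zero (w : List (Fin n)) :
    iterD w (fun _ => 0 : EuclideanSpace ℝ (Fin n) → ℂ) = fun _ => 0 := by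
  induction w with
  | nil => rfl
  | cons j w ih =>
    rw [iterD_cons, ih]
    funext x
    simp [partialD]

theorem isNegligible_zero : IsNegligible Ω (fun _ _ => 0) := by
  intro K _ _ w b
  refine ⟨0, Eventually.of_forall fun ε x _ => ?_⟩
  simp [iterD_zero]

theorem IsNegligible.isModerate {u : Eps → EuclideanSpace ℝ (Fin n) → ℂ}
    (h : IsNegligible Ω u) : IsModerate Ω u := fun K hK hKΩ w => ⟨0, h K hK hKΩ w 0⟩

theorem IsSmoothNet.partialD {u : Eps → EuclideanSpace ℝ (Fin n) → ℂ} (h : IsSmoothNet Ω u)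
    (j : Fin n) : IsSmoothNet Ω (fun ε => partialD j (u ε)) := fun ε => contDiffOn_partialD j (h ε)

theorem IsModerate.partialD {u : Eps → EuclideanSpace ℝ (Fin n) → ℂ} (h : IsModerate Ω u)
    (j : Fin n) : IsModerate Ω (fun ε => partialD j (u ε)) := by
  intro K hK hKΩ w
  simp only [iterD_partialD]
  exact h K hK hKΩ _

theorem IsNegligible.partialD {u : Eps → EuclideanSpace ℝ (Fin n) → ℂ} (h : IsNegligible Ω u)
    (j : Fin n) : IsNegligible Ω (fun ε => partialD j (u ε)) := by
  intro K hK hKΩ w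
  simp only [iterD_partialD]
  exact h K hK hKΩ _

theorem net_smul_apply (c : moderateNet ℂ) (u : Eps → EuclideanSpace ℝ (Fin n) → ℂ) :
    c • u = fun ε x => (c : Eps → ℂ) ε * u ε x := rfl

instance netModule : Module (moderateNet ℂ) (Eps → EuclideanSpace ℝ (Fin n) → ℂ) := inferInstance

variable (Ω)

/-- The module `E_M(Ω)` of moderate nets of smooth functions on `Ω`. -/
def moderateFun : Submodule (moderateNet ℂ) (Eps → EuclideanSpace ℝ (Fin n) → ℂ) where
  carrier := {u | IsSmoothNet Ω u ∧ IsModerate Ω u}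
  add_mem' := by
    rintro u v ⟨hu, mu⟩ ⟨hv, mv⟩
    have e : u + v = fun ε x => (fun _ : Eps => (1 : ℂ)) ε * u ε x
        + (fun _ : Eps => (1 : ℂ)) ε * v ε x := by
      funext ε x
      simp
    rw [e]
    exact ⟨hu.lin hv _ _, IsModerate.lin hu hv mu mv one_isBigO_epsPow one_isBigO_epsPow⟩
  zero_mem' := ⟨fun _ => contDiffOn_const, isNegligible_zero.isModerate⟩
  smul_mem' := by
    rintro ⟨c, a, hc⟩ u ⟨hu, mu⟩
    have e : (⟨c, a, hc⟩ : moderateNet ℂ) • u =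
        fun ε x => c ε * u ε x + (fun _ : Eps => (0 : ℂ)) ε * u ε x := by
      rw [net_smul_apply]
      funext ε x
      simp
    rw [e]
    exact ⟨hu.lin hu _ _, IsModerate.lin hu hu mu mu hc (zero_isBigO_epsPow 0)⟩

instance moderateFunModule : Module (moderateNet ℂ) (moderateFun Ω) := (moderateFun Ω).module

instance moderateFunSMul : SMul (moderateNet ℂ) (moderateFun Ω) :=
  (moderateFunModule Ω).toSMul

/-- The submodule `N(Ω)` of negligible nets. -/
def negligibleFun : Submodule (moderateNet ℂ) (moderateFun Ω) where
  carrier := {u | IsNegligible Ω (u : Eps → EuclideanSpace ℝ (Fin n) → ℂ)}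
  add_mem' := by
    rintro ⟨u, hu⟩ ⟨v, hv⟩ mu mv
    have h := IsNegligible.lin hu.1 hv.1 mu mv one_isBigO_epsPow one_isBigO_epsPow
    exact h.congr fun ε x _ => by simp
  zero_mem' := isNegligible_zero
  smul_mem' := by
    rintro ⟨c, a, hc⟩ ⟨u, hu⟩ mu
    have h := IsNegligible.lin hu.1 hu.1 mu mu hc (zero_isBigO_epsPow 0)
    exact h.congr fun ε x _ => by simp [net_smul_apply]

/-- The Colombeau space `G(Ω) = E_M(Ω) / N(Ω)` of generalized functions on the open set `Ω`. -/
def GenFun : Type := moderateFun Ω ⧸ negligibleFun Ω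

instance genFunAddCommGroup : AddCommGroup (GenFun Ω) :=
  inferInstanceAs (AddCommGroup (moderateFun Ω ⧸ negligibleFun Ω))

instance genFunNetModule : Module (moderateNet ℂ) (GenFun Ω) :=
  inferInstanceAs (Module (moderateNet ℂ) (moderateFun Ω ⧸ negligibleFun Ω))

variable {Ω}

/-- The class `[(u_ε)_ε]` of a moderate net. -/
def funClass (u : moderateFun Ω) : GenFun Ω := Submodule.Quotient.mk u

theorem funClass_surjective : Function.Surjective (funClass (Ω := Ω)) :=
  Submodule.Quotient.mk_surjective _

theorem funClass_eq_iff {u v : moderateFun Ω} :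
    funClass u = funClass v ↔ IsNegligible Ω (fun ε x =>
      (u : Eps → EuclideanSpace ℝ (Fin n) → ℂ) ε x - (v : Eps → EuclideanSpace ℝ (Fin n) → ℂ) ε x) :=
  Submodule.Quotient.eq _

theorem genFun_torsion :
    Module.IsTorsionBySet (moderateNet ℂ) (GenFun Ω) (negligibleNet ℂ : Set (moderateNet ℂ)) := by
  rintro u ⟨c, hc⟩
  obtain ⟨⟨u, hu⟩, rfl⟩ := funClass_surjective u
  refine (Submodule.Quotient.mk_eq_zero (negligibleFun Ω) (x := c • (⟨u, hu⟩ : moderateFun Ω))).2 ?_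
  intro K hK hKΩ w b
  obtain ⟨d, hd⟩ := hu.2 K hK hKΩ w
  refine UnifBigO.lin (hc (b - d)) (zero_isBigO_epsPow (b - d)) hd hd (by linarith) (by linarith)
    fun ε x hx => ?_
  have h := iterD_lin w ((c : Eps → ℂ) ε) 0 (hu.1 ε) (hu.1 ε) (hKΩ hx)
  simp only [zero_mul, add_zero] at h ⊢
  exact h

/-- The `ℂ̃`-module structure `[(c_ε)_ε] • [(u_ε)_ε] = [(c_ε u_ε)_ε]` on `G(Ω)`. -/
instance genFunModule : Module GenComplex (GenFun Ω) := 
  Module.IsTorsionBySet.module (I := negligibleNet ℂ) genFun_torsion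

theorem numClass_smul_funClass (c : moderateNet ℂ) (u : moderateFun Ω) :
    numClass c • funClass u = funClass (c • u) := rfl

/-- The operator `D_j = -i ∂_j` on representatives. -/
def dNet (j : Fin n) (u : moderateFun Ω) : moderateFun Ω :=
  ⟨fun ε x => -Complex.I * partialD j ((u : Eps → EuclideanSpace ℝ (Fin n) → ℂ) ε) x, by
    obtain ⟨u, hu, mu⟩ := u
    have hs := hu.partialD j
    have hm := mu.partialD j
    have hI : (fun _ : Eps => -Complex.I) =O[toZero] epsPow 0 :=
      IsBigO.of_bound 1 (Eventually.of_forall fun ε => by simp [epsPow])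
    have e : (fun ε x => -Complex.I * partialD j (u ε) x) = fun (ε : Eps) x =>
        (fun _ : Eps => -Complex.I) ε * partialD j (u ε) x
          + (fun _ : Eps => (0 : ℂ)) ε * partialD j (u ε) x := by
      funext ε x
      simp
    show IsSmoothNet Ω _ ∧ IsModerate Ω _
    rw [e]
    exact ⟨hs.lin hs _ _, IsModerate.lin hs hs hm hm hI (zero_isBigO_epsPow 0)⟩⟩

theorem partialD_lin (j : Fin n) (c d : ℂ) {f g : EuclideanSpace ℝ (Fin n) → ℂ}
    (hf : ContDiffOn ℝ ∞ f Ω) (hg : ContDiffOn ℝ ∞ g Ω) :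
    Set.EqOn (partialD j fun x => c * f x + d * g x)
      (fun x => c * partialD j f x + d * partialD j g x) Ω :=
  iterD_lin [j] c d hf hg

theorem dNet_lin (j : Fin n) (c d : moderateNet ℂ) (u v : moderateFun Ω) :
    funClass (dNet j (c • u + d • v)) = funClass (c • dNet j u + d • dNet j v) := by
  rw [funClass_eq_iff]
  refine isNegligible_zero.congr fun ε x hx => ?_
  have h := partialD_lin j ((c : Eps → ℂ) ε) ((d : Eps → ℂ) ε) (u.2.1 ε) (v.2.1 ε) hx
  change 0 = -Complex.I * partialD j (fun x => (c : Eps → ℂ) ε * (u : Eps → _ → ℂ) ε x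
      + (d : Eps → ℂ) ε * (v : Eps → _ → ℂ) ε x) x
    - ((c : Eps → ℂ) ε * (-Complex.I * partialD j ((u : Eps → _ → ℂ) ε) x)
      + (d : Eps → ℂ) ε * (-Complex.I * partialD j ((v : Eps → _ → ℂ) ε) x))
  rw [h]
  ring

theorem dNet_negligible (j : Fin n) {u : moderateFun Ω} (h : u ∈ negligibleFun Ω) :
    funClass (dNet j u) = 0 := by
  refine (Submodule.Quotient.mk_eq_zero (negligibleFun Ω)).2 ?_
  have hs := u.2.1.partialD j
  have hm := IsNegligible.partialD (show IsNegligible Ω (u : Eps → _ → ℂ) from h) j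
  have hI : (fun _ : Eps => -Complex.I) =O[toZero] epsPow 0 :=
    IsBigO.of_bound 1 (Eventually.of_forall fun ε => by simp [epsPow])
  exact (IsNegligible.lin hs hs hm hm hI (zero_isBigO_epsPow 0)).congr fun ε x _ => by
    simp [dNet]

theorem dNet_add (j : Fin n) (u v : moderateFun Ω) :
    funClass (dNet j (u + v)) = funClass (dNet j u) + funClass (dNet j v) := by
  have h := dNet_lin j 1 1 u v
  simp only [one_smul] at h
  exact h

theorem dNet_smul (j : Fin n) (c : moderateNet ℂ) (u : moderateFun Ω) :
    funClass (dNet j (c • u)) = numClass c • funClass (dNet j u) := by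
  have h := dNet_lin j c 0 u 0
  simp only [zero_smul, add_zero] at h
  exact h

/-- The operator `D_j = -i ∂_j`, `D_j [(u_ε)_ε] = [(-i ∂_j u_ε)_ε]`, as a `ℂ̃`-linear endomorphism
of `G(Ω)`. -/
def dOp (j : Fin n) : Module.End GenComplex (GenFun Ω) where
  toFun := Submodule.liftQ (negligibleFun Ω)
    ({ toFun := fun u => funClass (dNet j u)
       map_add' := dNet_add j
       map_smul' := dNet_smul j } : moderateFun Ω →ₗ[moderateNet ℂ] GenFun Ω)
    (fun _ hu => dNet_negligible j hu)
  map_add' := fun u v => map_add _ u v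
  map_smul' := by
    intro c u
    obtain ⟨c, rfl⟩ := numClass_surjective c
    obtain ⟨u, rfl⟩ := funClass_surjective u
    exact dNet_smul j c u

theorem dOp_funClass (j : Fin n) (u : moderateFun Ω) :
    dOp j (funClass u) = funClass (dNet j u) := rfl

/-- `D^α = D_1^{α_1} ⋯ D_n^{α_n}` on `G(Ω)`. -/
def dPow (α : Fin n →₀ ℕ) : Module.End GenComplex (GenFun Ω) :=
  (List.ofFn fun j => dOp (Ω := Ω) j ^ α j).prod

/-- The partial differential operator `P(D) = ∑_α c_α D^α` on `G(Ω)` with constant generalized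
coefficients `c_α ∈ ℂ̃`, where `P = ∑_α c_α X^α`. -/
def diffOp (P : MvPolynomial (Fin n) GenComplex) : Module.End GenComplex (GenFun Ω) :=
  ∑ α ∈ P.support, P.coeff α • dPow α

/-- The restriction of a moderate net to a smaller open set. -/
def restrictNet {V : TopologicalSpace.Opens (EuclideanSpace ℝ (Fin n))} (h : V ≤ Ω) :
    moderateFun Ω →ₗ[moderateNet ℂ] moderateFun V where
  toFun u := ⟨u, fun ε => (u.2.1 ε).mono h, fun K hK hKV => u.2.2 K hK (hKV.trans h)⟩
  map_add' _ _ := rfl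
  map_smul' _ _ := rfl

/-- The restriction map `G(Ω) → G(V)` for open `V ⊆ Ω`. -/
def restrict {V : TopologicalSpace.Opens (EuclideanSpace ℝ (Fin n))} (h : V ≤ Ω) :
    GenFun Ω →ₗ[moderateNet ℂ] GenFun V :=
  Submodule.mapQ (negligibleFun Ω) (negligibleFun V) (restrictNet h)
    (fun _ hu K hK hKV => hu K hK (hKV.trans h))

variable (Ω) in
/-- The set `G^∞(Ω) ⊆ G(Ω)` of regular generalized functions. -/
def regularFun : Set (GenFun Ω) :=
  {u | ∃ r : moderateFun Ω, funClass r = u ∧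
    IsRegular Ω (r : Eps → EuclideanSpace ℝ (Fin n) → ℂ)}

/-- The `G^∞`-singular support of `u ∈ G(Ω)`: the complement in `Ω` of the set of points which have
an open neighbourhood `V ⊆ Ω` with `u|_V ∈ G^∞(V)`. -/
def singSupp (u : GenFun Ω) : Set (EuclideanSpace ℝ (Fin n)) :=
  {x | x ∈ Ω ∧ ¬ ∃ (V : TopologicalSpace.Opens (EuclideanSpace ℝ (Fin n))) (h : V ≤ Ω),
    x ∈ V ∧ restrict h u ∈ regularFun V}

/-- `P(D)` is `G^∞`-hypoelliptic: `sing supp P(D)u = sing supp u` for all open `Ω ⊆ ℝⁿ` and all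
`u ∈ G(Ω)`. -/
def IsHypoelliptic (P : MvPolynomial (Fin n) GenComplex) : Prop :=
  ∀ (Ω : TopologicalSpace.Opens (EuclideanSpace ℝ (Fin n))) (u : GenFun Ω),
    singSupp (diffOp P u) = singSupp u

end Functions

end Colombeau

end

open Filter Topology Asymptotics
open scoped ContDiff

namespace Colombeau

variable {n : ℕ}

/-! A zero `ζ` of `P` gives the exponential solution `u = exp(i ζ·x)` of `P(D)u = 0`. Since `|exp(i
z·x)| ≤ exp(|x| ∑ |Im z_j|)`, log-type growth of `Im ζ` costs only a power of `ε` on each compact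
set, so `u` is a moderate net (`planeWave_mem_moderateFun`). As `D_j u = ζ_j u`, also `P(D)u = P(ζ)u
= 0` (`diffOp_eigenvector`), and hypoellipticity forces `u` to be regular near every point, in
particular near the origin. The derivative `∂_j^k u` at `0` is `(i ζ_j)^k`, so one exponent `b`
satisfies `|ζ_j|^k = O(ε^b)` for every `k` (`pow_isBigO_of_planeWave_regular`). Taking `k`-th roots
gives `|ζ_j| = O(ε^(b/k))`, where `b/k → 0` (`isBigO_of_pow_isBigO`). Thus `ζ` itself, and a
fortiori its real part, has valuation at least `0`. -/

/-! ### Plane waves and their derivatives -/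

/-- The exponent `x ↦ i ∑ z_j x_j` of a complex plane wave. -/
noncomputable def phase (z : Fin n → ℂ) : EuclideanSpace ℝ (Fin n) →L[ℝ] ℂ :=
  ∑ j, (Complex.I * z j) • (Complex.ofRealCLM ∘L EuclideanSpace.proj (𝕜 := ℝ) j)

theorem phase_apply (z : Fin n → ℂ) (x : EuclideanSpace ℝ (Fin n)) :
    phase z x = ∑ j, Complex.I * z j * (x j : ℂ) := by
  simp [phase]

/-- The complex plane wave `x ↦ exp (i ∑ z_j x_j)`. -/
noncomputable def planeWave (z : Fin n → ℂ) (x : EuclideanSpace ℝ (Fin n)) : ℂ :=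
  Complex.exp (phase z x)

theorem planeWave_zero (z : Fin n → ℂ) : planeWave z 0 = 1 := by simp [planeWave]

theorem contDiff_planeWave (z : Fin n → ℂ) : ContDiff ℝ ∞ (planeWave z) :=
  (phase z).contDiff.cexp

theorem partialD_const_mul_planeWave (j : Fin n) (c : ℂ) (z : Fin n → ℂ) :
    partialD j (fun x => c * planeWave z x) = fun x => Complex.I * z j * c * planeWave z x := by
  funext x
  have h : HasFDerivAt (fun x => c * planeWave z x) _ x :=
    ((phase z).hasFDerivAt.cexp (x := x)).const_mul c
  have hs : phase z (EuclideanSpace.single j 1) = Complex.I * z j := by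
    simp [phase_apply, apply_ite]
  rw [partialD, h.fderiv]
  change c * (planeWave z x * phase z (EuclideanSpace.single j 1)) = _
  rw [hs]
  ring

theorem iterD_planeWave (w : List (Fin n)) (z : Fin n → ℂ) :
    iterD w (planeWave z) = fun x => (w.map fun j => Complex.I * z j).prod * planeWave z x := by
  induction w with
  | nil => simp [iterD]
  | cons j w ih =>
    rw [iterD_cons, ih, partialD_const_mul_planeWave]
    simp

/-- Only the real part `-∑ x_j Im z_j` of the exponent affects the modulus. -/
theorem norm_planeWave_le (z : Fin n → ℂ) (x : EuclideanSpace ℝ (Fin n)) :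
    ‖planeWave z x‖ ≤ Real.exp (‖x‖ * ∑ j, |(z j).im|) := by
  rw [planeWave, Complex.norm_exp, Real.exp_le_exp, phase_apply, Complex.re_sum, Finset.mul_sum]
  refine Finset.sum_le_sum fun j _ => ?_
  have h : (Complex.I * z j * (x j : ℂ)).re = -(x j * (z j).im) := by simp [mul_comm]
  rw [h]
  refine (neg_le_abs _).trans ?_
  rw [abs_mul]
  exact mul_le_mul_of_nonneg_right (PiLp.norm_apply_le x j) (abs_nonneg _)

/-! ### Moderateness of plane waves of log-type -/

theorem eventually_lt_toZero {δ : ℝ} (hδ : 0 < δ) : ∀ᶠ ε : Eps in toZero, (ε : ℝ) < δ :=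
  preimage_mem_comap (Iio_mem_nhds hδ)

theorem epsPow_zero_isBigO_log :
    epsPow 0 =O[toZero] fun ε : Eps => Real.log (1 / (ε : ℝ)) := by
  refine IsBigO.of_bound 1 ((eventually_lt_toZero (Real.exp_pos (-1))).mono fun ε hε => ?_)
  have h : 1 ≤ Real.log (1 / (ε : ℝ)) := by
    rw [one_div, Real.log_inv, le_neg]
    exact (Real.log_le_iff_le_exp ε.2.1).2 hε.le
  simpa [epsPow] using h.trans (le_abs_self _)

/-- Log-type provides the bound for one representative only. Any other differs from it by a
negligible net, in particular by `O(1)`, which `log(1/ε)` absorbs. -/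
theorem IsLogType.im_isBigO_log {a : Fin n → moderateNet ℂ}
    (h : IsLogType (imPart fun j => numClass (a j))) (j : Fin n) :
    (fun ε => ((a j : Eps → ℂ) ε).im) =O[toZero] fun ε : Eps => Real.log (1 / (ε : ℝ)) := by
  obtain ⟨r, hr, hlog⟩ := h
  have h1 : (r j : Eps → ℝ) =O[toZero] fun ε : Eps => Real.log (1 / (ε : ℝ)) := by
    refine IsBigO.trans (IsBigO.of_bound 1 (Eventually.of_forall fun ε => ?_)) hlog
    rw [one_mul, normNet, norm_norm]
    exact PiLp.norm_apply_le
      (WithLp.toLp 2 fun j => (r j : Eps → ℝ) ε : EuclideanSpace ℝ (Fin n)) j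
  have h2 := (numClass_eq_iff.1 (hr j) 0).trans epsPow_zero_isBigO_log
  refine (h1.sub h2).congr_left fun ε => ?_
  simp [mapNet]

/-- The net of plane waves with frequencies `z_ε` is moderate if `|Im z_ε| = O(log(1/ε))`. -/
theorem planeWave_mem_moderateFun (Ω : TopologicalSpace.Opens (EuclideanSpace ℝ (Fin n)))
    (a : Fin n → moderateNet ℂ)
    (h : ∀ j, (fun ε => ((a j : Eps → ℂ) ε).im) =O[toZero]
      fun ε : Eps => Real.log (1 / (ε : ℝ))) :
    (fun ε => planeWave fun j => (a j : Eps → ℂ) ε) ∈ moderateFun Ω := by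
  refine ⟨fun ε => (contDiff_planeWave _).contDiffOn, fun K hK _ w => ?_⟩
  obtain ⟨C, hC⟩ := (IsBigO.fun_sum (s := Finset.univ) fun j _ => (h j).abs_left).bound
  obtain ⟨R, hR0, hR⟩ := hK.isBounded.exists_pos_norm_le
  -- With `|x| ≤ R` on `K` and `∑ |Im z_j| ≤ C log(1/ε)`, the wave is at most `exp(R C log(1/ε)) =
  -- ε^(-RC)`.
  have hu : UnifBigO (fun ε => planeWave fun j => (a j : Eps → ℂ) ε) K (-(R * C)) := by
    refine ⟨1, hC.mono fun ε hε x hx => (norm_planeWave_le _ x).trans ?_⟩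
    have hl : 0 ≤ Real.log (1 / (ε : ℝ)) :=
      Real.log_nonneg (by rw [one_div]; exact (one_le_inv₀ ε.2.1).2 ε.2.2)
    rw [Real.norm_of_nonneg (Finset.sum_nonneg fun _ _ => abs_nonneg _),
      Real.norm_of_nonneg hl] at hε
    rw [one_mul, epsPow, Real.rpow_def_of_pos ε.2.1, Real.exp_le_exp]
    calc _ ≤ R * (C * Real.log (1 / (ε : ℝ))) :=
          mul_le_mul (hR x hx) hε (Finset.sum_nonneg fun _ _ => abs_nonneg _) hR0.le
      _ = _ := by rw [one_div, Real.log_inv]; ring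
  have hI : (fun _ : Eps => Complex.I) ∈ moderateNet ℂ :=
    ⟨0, IsBigO.of_bound 1 (Eventually.of_forall fun ε => by simp [epsPow])⟩
  -- A derivative multiplies the wave by a product of frequencies. Its order of growth `d` may
  -- depend on `w`, which moderateness permits.
  have hc : (fun ε => (w.map fun j => Complex.I * (a j : Eps → ℂ) ε).prod) ∈ moderateNet ℂ := by
    induction w with
    | nil => exact one_mem _
    | cons j w ih => exact mul_mem (mul_mem hI (a j).2) ih
  obtain ⟨d, hd⟩ := hc
  refine ⟨d + -(R * C), UnifBigO.lin hd (zero_isBigO_epsPow d) hu hu le_rfl le_rfl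
    fun ε x _ => ?_⟩
  rw [iterD_planeWave, zero_mul, add_zero]

/-! ### Plane waves as joint eigenvectors of the `D_j` -/

section Eigenvector

variable {Ω : TopologicalSpace.Opens (EuclideanSpace ℝ (Fin n))}

theorem dOp_planeWave (a : Fin n → moderateNet ℂ)
    (h : (fun ε => planeWave fun j => (a j : Eps → ℂ) ε) ∈ moderateFun Ω) (j : Fin n) :
    dOp j (funClass ⟨_, h⟩) = numClass (a j) • funClass ⟨_, h⟩ := by
  rw [dOp_funClass, numClass_smul_funClass]
  -- The eigenvalue equation already holds exactly for representatives, as `-i · i z_j = z_j`.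
  congr 1
  refine Subtype.ext (funext fun ε => funext fun x => ?_)
  have hd := congrFun (partialD_const_mul_planeWave j 1 fun j => (a j : Eps → ℂ) ε) x
  simp only [one_mul, mul_one] at hd
  change -Complex.I * partialD j (planeWave fun j => (a j : Eps → ℂ) ε) x =
    (a j : Eps → ℂ) ε * planeWave (fun j => (a j : Eps → ℂ) ε) x
  rw [hd, ← mul_assoc, ← mul_assoc, neg_mul, Complex.I_mul_I, neg_neg, one_mul]

variable {ζ : Fin n → GenComplex} {u : GenFun Ω}

theorem pow_dOp_eigenvector {j : Fin n} (hu : dOp j u = ζ j • u) (k : ℕ) :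
    (dOp j ^ k) u = ζ j ^ k • u := by
  induction k with
  | zero => simp
  | succ k ih => rw [pow_succ', Module.End.mul_apply, ih, map_smul, hu, smul_smul, pow_succ]

/-- Pairing each operator with its eigenvalue lets a single induction treat the noncommutative
product. Scalars pass through the operators by linearity, so commutation of the operators is not
needed. -/
theorem list_prod_eigenvector (l : List (Module.End GenComplex (GenFun Ω) × GenComplex))
    (h : ∀ p ∈ l, p.1 u = p.2 • u) : (l.map Prod.fst).prod u = (l.map Prod.snd).prod • u := by
  induction l with
  | nil => simp
  | cons p l ih =>
    rw [List.map_cons, List.prod_cons, Module.End.mul_apply,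
      ih fun q hq => h q (List.mem_cons_of_mem _ hq), map_smul, h p List.mem_cons_self,
      smul_smul, List.map_cons, List.prod_cons, mul_comm]

theorem dPow_eigenvector (hu : ∀ j, dOp j u = ζ j • u) (α : Fin n →₀ ℕ) :
    dPow α u = (∏ j, ζ j ^ α j) • u := by
  have h := list_prod_eigenvector (u := u)
    (List.ofFn fun j => (dOp (Ω := Ω) j ^ α j, ζ j ^ α j)) (by
      intro p hp
      obtain ⟨j, rfl⟩ := List.mem_ofFn.1 hp
      exact pow_dOp_eigenvector (hu j) _)
  simp only [List.map_ofFn, List.prod_ofFn, Function.comp_def] at h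
  exact h

theorem diffOp_eigenvector (hu : ∀ j, dOp j u = ζ j • u)
    (P : MvPolynomial (Fin n) GenComplex) : diffOp P u = MvPolynomial.eval ζ P • u := by
  rw [diffOp, LinearMap.sum_apply, MvPolynomial.eval_eq', Finset.sum_smul]
  refine Finset.sum_congr rfl fun α _ => ?_
  rw [LinearMap.smul_apply, dPow_eigenvector hu, smul_smul]

theorem singSupp_zero : singSupp (0 : GenFun Ω) = ∅ := by
  refine Set.eq_empty_of_forall_notMem fun x hx => hx.2 ⟨Ω, le_rfl, hx.1, ?_⟩
  rw [map_zero]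
  exact ⟨0, rfl, fun K hK hKΩ => ⟨0, fun w => isNegligible_zero K hK hKΩ w 0⟩⟩

end Eigenvector

/-! ### From regularity to the valuation -/

/-- Root extraction: because `b` is the same for all powers, `b / k` eventually exceeds any given `c
< 0`. -/
theorem isBigO_of_pow_isBigO {z : Eps → ℂ} {b : ℝ}
    (h : ∀ k : ℕ, (fun ε => z ε ^ k) =O[toZero] epsPow b) {c : ℝ} (hc : c < 0) :
    z =O[toZero] epsPow c := by
  -- Multiplying by `c < 0` reverses the inequality. The power used is `k + 1`, so that a root can
  -- be taken even when `k = 0`.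
  obtain ⟨k, hk⟩ := exists_nat_ge (b / c)
  have hkb : c * (k + 1 : ℕ) ≤ b := by
    have := (div_le_iff_of_neg hc).1 (hk.trans (Nat.cast_le.2 k.le_succ))
    rwa [mul_comm] at this
  obtain ⟨C, hC⟩ := ((h (k + 1)).trans (epsPow_isBigO hkb)).bound
  -- A constant that is at least `1` and at least `C` satisfies `C ≤ (max C 1)^(k+1)`, which avoids
  -- a fractional power of `C`.
  refine IsBigO.of_bound (max C 1) (hC.mono fun ε hε => ?_)
  have hp : epsPow (c * (k + 1 : ℕ)) ε = epsPow c ε ^ (k + 1) := by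
    rw [epsPow, Real.rpow_mul ε.2.1.le, Real.rpow_natCast, epsPow]
  have hpos := epsPow_pos c ε
  rw [hp, norm_pow, Real.norm_of_nonneg (pow_nonneg hpos.le _)] at hε
  rw [Real.norm_of_nonneg hpos.le]
  refine le_of_pow_le_pow_left₀ k.succ_ne_zero
    (mul_nonneg (zero_le_one.trans (le_max_right _ _)) hpos.le) (hε.trans ?_)
  rw [mul_pow]
  exact mul_le_mul_of_nonneg_right
    ((le_max_left _ _).trans (le_self_pow₀ (le_max_right _ _) k.succ_ne_zero))
    (pow_nonneg hpos.le _)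

/-- Regularity of a net of plane waves near the origin bounds all powers of its frequencies by a
single power of `ε`. -/
theorem pow_isBigO_of_planeWave_regular {V : TopologicalSpace.Opens (EuclideanSpace ℝ (Fin n))}
    (h0 : (0 : EuclideanSpace ℝ (Fin n)) ∈ V) (a : Fin n → moderateNet ℂ)
    (h : (fun ε => planeWave fun j => (a j : Eps → ℂ) ε) ∈ moderateFun V)
    (hreg : funClass ⟨_, h⟩ ∈ regularFun V) :
    ∃ b : ℝ, ∀ (j : Fin n) (k : ℕ), (fun ε => (a j : Eps → ℂ) ε ^ k) =O[toZero] epsPow b := by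
  obtain ⟨r, hr, hreg⟩ := hreg
  have hneg := funClass_eq_iff.1 hr
  have hK : ({0} : Set (EuclideanSpace ℝ (Fin n))) ⊆ V := Set.singleton_subset_iff.2 h0
  -- The single point `0` suffices as compact set: the wave equals `1` there, so its derivatives are
  -- pure products of frequencies.
  obtain ⟨b, hb⟩ := hreg {0} isCompact_singleton hK
  refine ⟨b, fun j k => ?_⟩
  set w : List (Fin n) := List.replicate k j
  -- The wave need not be the regular representative: it is `r` minus the negligible net `r - wave`,
  -- so the exponent `b` of `r` carries over to every derivative of the wave.
  have hd := UnifBigO.lin (s := b) one_isBigO_epsPow (one_isBigO_epsPow.neg_left) (hb w)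
    (hneg {0} isCompact_singleton hK w b) (by simp) (by simp)
    (z := fun ε => iterD w (planeWave fun j => (a j : Eps → ℂ) ε)) (by
      intro ε x hx
      have e := iterD_lin w 1 (-1) (r.2.1 ε) (h.1 ε) (hK hx)
      simp only [one_mul, neg_one_mul, ← sub_eq_add_neg] at e
      simp only [one_mul, neg_one_mul, ← sub_eq_add_neg]
      rw [e, sub_sub_cancel])
  obtain ⟨C, hC⟩ := hd
  refine IsBigO.of_bound C (hC.mono fun ε hε => ?_)
  have e : ‖iterD w (planeWave fun j => (a j : Eps → ℂ) ε) 0‖ ≤ C * epsPow b ε := hε 0 rfl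
  rw [iterD_planeWave] at e
  beta_reduce at e
  rw [planeWave_zero, mul_one, List.map_replicate, List.prod_replicate, norm_pow,
    norm_mul, Complex.norm_I, one_mul] at e
  rwa [norm_pow, Real.norm_of_nonneg (epsPow_pos b ε).le]

/-- The valuation is a supremum, so bounds for all `c < 0` are enough. Root extraction gives no
bound at `c = 0`. -/
theorem val_nonneg_of_isBigO {𝕜 : Type} [RCLike 𝕜] (a : moderateNet 𝕜)
    (h : ∀ c : ℝ, c < 0 → (a : Eps → 𝕜) =O[toZero] epsPow c) : 0 ≤ val (numClass a) := by
  refine le_of_forall_lt fun s hs => ?_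
  obtain ⟨c, hsc, hc⟩ := EReal.lt_iff_exists_real_btwn.1 hs
  exact hsc.trans_le (le_sSup ⟨c, rfl, a, rfl, h c (EReal.coe_neg'.1 hc)⟩)

end Colombeau

theorem theorem4p5 {n : ℕ} (P : MvPolynomial (Fin n) Colombeau.GenComplex)
    (hP : Colombeau.IsHypoelliptic P) (ζ : Fin n → Colombeau.GenComplex)
    (hζ : MvPolynomial.eval ζ P = 0)
    (hlog : Colombeau.IsLogType (Colombeau.imPart ζ)) :
    0 ≤ Colombeau.val (Colombeau.genNorm (Colombeau.rePart ζ)) := by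
  choose a ha using fun j => Colombeau.numClass_surjective (ζ j)
  obtain rfl : (fun j => Colombeau.numClass (a j)) = ζ := funext ha
  -- Two open sets are needed: `⊤`, where hypoellipticity is applied, and the neighbourhood `V` of
  -- `0` that it yields. Restricting the class to `V` keeps the same net.
  have hmod := fun Ω => Colombeau.planeWave_mem_moderateFun Ω a hlog.im_isBigO_log
  have hsing := hP ⊤ (Colombeau.funClass ⟨_, hmod ⊤⟩)
  rw [Colombeau.diffOp_eigenvector (Colombeau.dOp_planeWave a (hmod ⊤)), hζ, zero_smul,
    Colombeau.singSupp_zero] at hsing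
  have h0 := Set.eq_empty_iff_forall_notMem.1 hsing.symm 0
  obtain ⟨V, hV, h0V, hreg⟩ := not_not.1 fun hn => h0 ⟨trivial, hn⟩
  obtain ⟨b, hb⟩ := Colombeau.pow_isBigO_of_planeWave_regular h0V a (hmod V) hreg
  have e : Colombeau.rePart (fun j => Colombeau.numClass (a j)) =
      fun j => Colombeau.numClass (Colombeau.mapNet Complex.reCLM (a j)) := rfl
  rw [e, Colombeau.genNorm_numClass]
  -- The bound on the complex frequency `ζ_j` passes to its real part, and from the components to
  -- the Euclidean norm.
  exact Colombeau.val_nonneg_of_isBigO _ fun c hc => Colombeau.normNet_isBigO _ fun j =>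
    (Complex.reCLM.isBigO_comp _ _).trans (Colombeau.isBigO_of_pow_isBigO (hb j) hc)
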